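/- Let $F$ be an algebraically closed field of characteristic $0$, let $n\ge 2$, $M_n=M_n(F)$, and let $f\in F\langle x_1,\dots,x_d\rangle$ be a noncommutative polynomial. Write $\operatorname{im}(f)=\{f(a_1,\dots,a_d): a_1,\dots,a_d\in M_n\}$ and, for $a\in M_n$, $a^\sim=\{\lambda tat^{-1}: t\in GL_n(F),\ \lambda\in F\}$. Call $f$ *finite on* $M_n$ if there are $a_1,\dots,a_k\in M_n$ with $\{0\}\ne\operatorname{im}(f)\subseteq a_1^\sim\cup\dots\cup a_k^\sim$. Call a polynomial *central* on $M_n$ if all its values on $M_n$ are scalar matrices and not all of them are $0$. For an integer $j\ge 1$, call $f$ *$j$-central* on $M_n$ if $f^j$ is central on $M_n$ and $f^i$ is not central on $M_n$ for $1\le i<j$. Then $f$ is finite on $M_n$ if and only if $f$ is $j$-central on $M_n$ for some integer $j\ge1$. Moreover, if $f$ is $j$-central on $M_n$, then $j$ divides $n$ and, for every primitive $j$-th root of unity $\mu\in F$, denoting by $\mathbf w_j\in M_n$ the diagonal matrix with diagonal blocks $\mathbf 1_r,\mu\mathbf 1_r,\dots,\mu^{j-1}\mathbf 1_r$, $r=n/j$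 (where $\mathbf 1_r$ is the $r\times r$ identity matrix), the following hold: 1. every nonnilpotent matrix in $\operatorname{im}(f)$ is similar to a scalar multiple of $\mathbf w_j$; 2. there are finitely many nilpotent matrices $n_2,\dots,n_k\in M_n$ with $\operatorname{im}(f)\subseteq\mathbf w_j^\sim\cup n_2^\sim\cup\dots\cup n_k^\sim$; 3. for every integer $m\ge j$, $\operatorname{im}(f^m)\subseteq(\mathbf w_j^m)^\sim$, and $\operatorname{im}(f^m)$ contains a nonzero scalar multiple of $\mathbf w_j^m$ (so, modulo nonzero scalars, the only nonzero similarity orbit in $\operatorname{im}(f^m)$ is that of $\mathbf w_j^m$); 4. $\operatorname{im}(f^{j+1})\subseteq\mathbf w_j^\sim$. -/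

import Mathlib

namespace NCPoly

/-- The image of the noncommutative polynomial `f` on the matrix algebra `M_n(F)`. -/
def image {F : Type*} [Field F] (n : ℕ) {d : ℕ} (f : FreeAlgebra F (Fin d)) :
    Set (Matrix (Fin n) (Fin n) F) :=
  {A | ∃ a : Fin d → Matrix (Fin n) (Fin n) F, A = FreeAlgebra.lift F a f}

/-- `a^∼`: all scalar multiples (zero included) of all matrices similar to `a`. -/
def simScalar {F : Type*} [Field F] {n : ℕ} (a : Matrix (Fin n) (Fin n) F) :
    Set (Matrix (Fin n) (Fin n) F) :=
  {A | ∃ (c : F) (t : (Matrix (Fin n) (Fin n) F)ˣ),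
    A = c • ((t : Matrix (Fin n) (Fin n) F) * a * ((t⁻¹ : (Matrix (Fin n) (Fin n) F)ˣ) :
      Matrix (Fin n) (Fin n) F))}

/-- `f` is finite on `M_n(F)`: `{0} ≠ im f ⊆ a₁^∼ ∪ ⋯ ∪ a_k^∼` for some matrices `a_i`. -/
def IsFiniteOn {F : Type*} [Field F] (n : ℕ) {d : ℕ} (f : FreeAlgebra F (Fin d)) : Prop :=
  image n f ≠ {0} ∧
    ∃ S : Set (Matrix (Fin n) (Fin n) F), S.Finite ∧ image n f ⊆ ⋃ a ∈ S, simScalar a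

/-- `f` is a polynomial identity of `M_n(F)`. -/
def IsIdentity {F : Type*} [Field F] (n : ℕ) {d : ℕ} (f : FreeAlgebra F (Fin d)) : Prop :=
  ∀ a : Fin d → Matrix (Fin n) (Fin n) F, FreeAlgebra.lift F a f = 0

/-- `f` is a central polynomial of `M_n(F)`: all its values are scalar matrices, and it is not a
polynomial identity. -/
def IsCentral {F : Type*} [Field F] (n : ℕ) {d : ℕ} (f : FreeAlgebra F (Fin d)) : Prop :=
  (∀ a : Fin d → Matrix (Fin n) (Fin n) F, ∃ c : F,
      FreeAlgebra.lift F a f = c • (1 : Matrix (Fin n) (Fin n) F)) ∧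
    ¬ IsIdentity n f

/-- `f` is `j`-central on `M_n(F)`, where `j` is a positive integer. -/
def IsPowCentral {F : Type*} [Field F] (n : ℕ) {d : ℕ} (j : ℕ) (f : FreeAlgebra F (Fin d)) :
    Prop :=
  1 ≤ j ∧ IsCentral n (f ^ j) ∧ ∀ i : ℕ, 1 ≤ i → i < j → ¬ IsCentral n (f ^ i)

/-- For `j ∣ n`, `r = n / j` and `μ` a primitive `j`-th root of unity, this is the matrix `w_j`:
diagonal, with `1, μ, …, μ ^ (j - 1)` on the diagonal in this order, each repeated `r` times. -/
def w {F : Type*} [Field F] (n j : ℕ) (μ : F) : Matrix (Fin n) (Fin n) F :=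
  Matrix.diagonal fun i : Fin n => μ ^ ((i : ℕ) / (n / j))

end NCPoly

/-! Every matrix over `F` is the specialization at `(1, 1)` of an element of `twistedAlgebra n ω`,
an algebra of matrices over `F[x][y]` whose nonzero elements all have nonzero determinant. A value
of `f` thus lifts to an element `r` of this algebra, and all specializations of `r` are again values
of `f`. If a finite product of determinants vanishes at each specialization, one factor vanishes
identically, and if that factor is the determinant of an element of the algebra, the element itself
is `0`. Hence finitely many alternatives that could vary from value to value collapse to one matrix
equation for `r`.

This is used twice. Finiteness gives finitely many candidates for the ratio of an eigenvalue of `A ^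
n` to `det A`, so `f ^ n` is scalar-valued (`pow_scalar_of_finite`). If `A ^ j` is scalar, the trace
of `A` is one of finitely many multiples of an eigenvalue, so a value of a polynomial with scalar
`j`-th powers is scalar or traceless (`trace_eq_zero_or_scalar`).

Applied to `f ^ i`, the second fact makes the traces of `f(a) ^ i` vanish for `0 < i < j`. A
nonnilpotent value, normalized to have `j`-th power `1`, then has all `j`-th roots of unity as
eigenvalues with equal multiplicity `n / j`, so it is similar to `w n j μ`. Nilpotent values fall
into finitely many classes by Jordan form. -/

namespace NCPoly

open Polynomial

/-! ### A generic cyclic algebra over the polynomial ring in two variables. -/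

section TwistedAlgebra

variable {F : Type*} [Field F] {n : ℕ} [NeZero n]

/-- The `F`-algebra endomorphism `x ↦ ω x`, `y ↦ y` of `F[x][y]`. -/
noncomputable def scaleInner (ω : F) : F[X][X] →ₐ[F] F[X][X] :=
  Polynomial.mapAlgHom (Polynomial.aeval (C ω * X : F[X]))

/-- The `F`-algebra endomorphism `x ↦ x`, `y ↦ ω y` of `F[x][y]`. -/
noncomputable def scaleOuter (ω : F) : F[X][X] →ₐ[F] F[X][X] :=
  (Polynomial.aeval (C (C ω) * X : F[X][X]) : F[X][X] →ₐ[F[X]] F[X][X]).restrictScalars F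

/-- Evaluation of `F[x][y]` at a point of the plane. -/
noncomputable def evalPoint (x y : F) : F[X][X] →ₐ[F] F :=
  (Polynomial.aeval x).comp
    ((Polynomial.aeval (C y : F[X]) : F[X][X] →ₐ[F[X]] F[X]).restrictScalars F)

theorem coeff_scaleInner (ω : F) (p : F[X][X]) (m : ℕ) :
    (scaleInner ω p).coeff m = (p.coeff m).comp (C ω * X) := by
  simp [scaleInner, Polynomial.coeff_map, Polynomial.comp, Polynomial.aeval_def,
    Polynomial.algebraMap_eq]

theorem coeff_scaleOuter (ω : F) (p : F[X][X]) (m : ℕ) :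
    (scaleOuter ω p).coeff m = ω ^ m • p.coeff m := by
  have : scaleOuter ω p = p.comp (C (C ω) * X) := by
    simp [scaleOuter, Polynomial.comp, Polynomial.aeval_def, Polynomial.algebraMap_eq]
  rw [this, comp_C_mul_X_coeff, smul_eq_C_mul, mul_comm, C_pow]

theorem evalPoint_apply (x y : F) (p : F[X][X]) :
    evalPoint x y p = (p.eval (C y)).eval x := by
  simp [evalPoint]

theorem eq_zero_of_evalPoint [Infinite F] {p : F[X][X]} (h : ∀ x y, evalPoint x y p = 0) :
    p = 0 := by
  by_contra hp
  refine hp (Polynomial.eq_zero_of_infinite_isRoot p ?_)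
  refine Set.Infinite.mono (s := Set.range (C : F → F[X])) ?_
    (Set.infinite_range_of_injective C_injective)
  rintro _ ⟨y, rfl⟩
  refine Polynomial.funext fun x => ?_
  rw [← evalPoint_apply, h, eval_zero]

theorem comp_C_mul_X_ne_zero {ω : F} (hω : ω ≠ 0) {p : F[X]} (hp : p ≠ 0) :
    p.comp (C ω * X) ≠ 0 := by
  obtain ⟨m, hm⟩ : ∃ m, p.coeff m ≠ 0 := by
    by_contra! h
    exact hp (Polynomial.ext fun m => by simp [h])
  intro h
  have := congrArg (fun q => q.coeff m) h
  simp only [comp_C_mul_X_coeff, coeff_zero] at this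
  exact mul_ne_zero hm (pow_ne_zero _ hω) this

/-- The matrices over `F[x][y]` on which scaling `x` or `y` by `ω` acts as conjugation by the
cyclic shift or by `diag(1, ω, …, ω ^ (n - 1))`. -/
noncomputable def twistedAlgebra (n : ℕ) [NeZero n] (ω : F) :
    Subalgebra F (Matrix (Fin n) (Fin n) F[X][X]) where
  carrier := {r | r.submatrix (Equiv.addRight (1 : Fin n)) (Equiv.addRight (1 : Fin n)) =
      (scaleInner ω).mapMatrix r ∧
    (scaleOuter ω).mapMatrix r * Matrix.diagonal (fun i : Fin n => C (C (ω ^ (i : ℕ)))) =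
      Matrix.diagonal (fun i : Fin n => C (C (ω ^ (i : ℕ)))) * r}
  mul_mem' {r s} hr hs := by
    refine ⟨?_, ?_⟩
    · rw [map_mul, ← hr.1, ← hs.1, Matrix.submatrix_mul_equiv]
    · rw [map_mul, mul_assoc, hs.2, ← mul_assoc, hr.2, mul_assoc]
  add_mem' {r s} hr hs := by
    refine ⟨?_, ?_⟩
    · rw [map_add, ← hr.1, ← hs.1, Matrix.submatrix_add]; rfl
    · rw [map_add, add_mul, hr.2, hs.2, mul_add]
  algebraMap_mem' c := by
    refine ⟨?_, ?_⟩
    · rw [AlgHom.commutes, Matrix.algebraMap_eq_diagonal, Matrix.submatrix_diagonal_equiv]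
      rfl
    · rw [AlgHom.commutes]
      exact Algebra.commutes _ _

variable {ω : F}

theorem twistedAlgebra_inner {r : Matrix (Fin n) (Fin n) F[X][X]} (hr : r ∈ twistedAlgebra n ω)
    (a b : Fin n) : r (a + 1) (b + 1) = scaleInner ω (r a b) :=
  congrFun (congrFun hr.1 a) b

theorem twistedAlgebra_outer {r : Matrix (Fin n) (Fin n) F[X][X]} (hr : r ∈ twistedAlgebra n ω)
    (a b : Fin n) : scaleOuter ω (r a b) * C (C (ω ^ (b : ℕ))) = C (C (ω ^ (a : ℕ))) * r a b := by
  have := congrFun (congrFun hr.2 a) b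
  rwa [Matrix.mul_diagonal, Matrix.diagonal_mul] at this

theorem smul_one_mem_twistedAlgebra {u : F[X][X]} (h₁ : scaleInner ω u = u)
    (h₂ : scaleOuter ω u = u) :
    u • (1 : Matrix (Fin n) (Fin n) F[X][X]) ∈ twistedAlgebra n ω := by
  refine ⟨?_, ?_⟩
  · ext1 a b
    by_cases hab : a = b <;> simp [hab, h₁]
  · have : (scaleOuter ω).mapMatrix (u • (1 : Matrix (Fin n) (Fin n) F[X][X])) = u • 1 := by
      ext1 a b
      by_cases hab : a = b <;> simp [hab, h₂]
    rw [this, smul_mul_assoc, mul_smul_comm, one_mul, mul_one]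

/-- Both scalings act on `r` as conjugations, which preserve the determinant. -/
theorem det_smul_one_mem_twistedAlgebra (hω : ω ≠ 0) {r : Matrix (Fin n) (Fin n) F[X][X]}
    (hr : r ∈ twistedAlgebra n ω) : r.det • 1 ∈ twistedAlgebra n ω := by
  apply smul_one_mem_twistedAlgebra
  · rw [AlgHom.map_det, ← hr.1, Matrix.det_submatrix_equiv_self]
  · have h := congrArg Matrix.det hr.2
    rw [Matrix.det_mul, Matrix.det_mul, mul_comm, ← AlgHom.map_det] at h
    refine mul_left_cancel₀ ?_ h
    rw [Matrix.det_diagonal, Finset.prod_ne_zero_iff]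
    intro a _
    simp [hω]

theorem trace_smul_one_mem_twistedAlgebra (hω : ω ≠ 0) {r : Matrix (Fin n) (Fin n) F[X][X]}
    (hr : r ∈ twistedAlgebra n ω) : r.trace • 1 ∈ twistedAlgebra n ω := by
  apply smul_one_mem_twistedAlgebra
  · rw [Matrix.trace, map_sum]
    conv_rhs => rw [← Equiv.sum_comp (Equiv.addRight (1 : Fin n))]
    exact Finset.sum_congr rfl fun a _ => (twistedAlgebra_inner hr a a).symm
  · rw [Matrix.trace, map_sum]
    refine Finset.sum_congr rfl fun a _ => ?_
    have h := twistedAlgebra_outer hr a a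
    rw [mul_comm] at h
    exact mul_left_cancel₀ (by simp [hω]) h

theorem forall_of_add_one {P : Fin n → Prop} (h0 : P 0) (h1 : ∀ k, P k → P (k + 1)) (k : Fin n) :
    P k := by
  obtain ⟨m, rfl⟩ := Nat.exists_eq_succ_of_ne_zero (NeZero.ne n)
  induction k using Fin.induction with
  | zero => exact h0
  | succ i ih => simpa using h1 _ ih

/-- Let `c` be the matrix of coefficients of the lowest power `y ^ N` occurring in `r`. The relation
for `y` confines `c` to one cyclic diagonal, and the relation for `x` carries a nonzero entry along
that whole diagonal. So `c` is an invertible diagonal matrix up to a permutation of columns, and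
`det c` is the lowest coefficient of `det r`. -/
theorem det_ne_zero_of_mem_twistedAlgebra (hω : IsPrimitiveRoot ω n)
    {r : Matrix (Fin n) (Fin n) F[X][X]} (hr : r ∈ twistedAlgebra n ω) (h0 : r ≠ 0) :
    r.det ≠ 0 := by
  classical
  have hω0 : ω ≠ 0 := hω.ne_zero (NeZero.ne n)
  have hex : ∃ m, ∃ a b, (r a b).coeff m ≠ 0 := by
    by_contra! h
    exact h0 (Matrix.ext fun a b => Polynomial.ext fun m => by simp [h m a b])
  obtain ⟨a₀, b₀, hab⟩ := Nat.find_spec hex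
  have hmin : ∀ m < Nat.find hex, ∀ a b, (r a b).coeff m = 0 := by
    intro m hm a b
    have := Nat.find_min hex hm
    push Not at this
    exact this a b
  set N := Nat.find hex
  have hdvd : ∀ a b, ∃ q, r a b = X ^ N * q := fun a b =>
    X_pow_dvd_iff.2 fun m hm => hmin m hm a b
  choose q hq using hdvd
  have hrq : r = (X ^ N : F[X][X]) • Matrix.of q := by
    ext1 a b
    simpa using hq a b
  set c : Matrix (Fin n) (Fin n) F[X] := fun a b => (r a b).coeff N with hc
  have hqc : constantCoeff.mapMatrix (Matrix.of q) = c := by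
    ext1 a b
    simp [hc, hq a b, mul_comm (X ^ N), coeff_mul_X_pow']
  have hshift : ∀ a b, c a b ≠ 0 → c (a + 1) (b + 1) ≠ 0 := by
    intro a b h
    simp only [hc]
    rw [twistedAlgebra_inner hr, coeff_scaleInner]
    exact comp_C_mul_X_ne_zero hω0 h
  have hpos : ∀ a b, c a b ≠ 0 → ω ^ N * ω ^ (b : ℕ) = ω ^ (a : ℕ) := by
    intro a b h
    have := congrArg (fun p => coeff p N) (twistedAlgebra_outer hr a b)
    simp only [coeff_C_mul, coeff_mul_C, coeff_scaleOuter, smul_eq_C_mul] at this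
    rw [mul_right_comm, ← C_mul] at this
    exact C_injective (mul_right_cancel₀ h this)
  have hk : ∀ k, c (a₀ + k) (b₀ + k) ≠ 0 := by
    refine forall_of_add_one (by simpa using hab) fun k h => ?_
    rw [← add_assoc, ← add_assoc]
    exact hshift _ _ h
  have hd : ∀ a, c a (a + (b₀ - a₀)) ≠ 0 := by
    intro a
    have := hk (a - a₀)
    rwa [add_sub_cancel, show b₀ + (a - a₀) = a + (b₀ - a₀) by abel] at this
  have huniq : ∀ a b, b ≠ a + (b₀ - a₀) → c a b = 0 := by
    intro a b hb
    by_contra h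
    -- Both columns satisfy the same congruence modulo `n` in row `a`, hence coincide.
    have h2 := (hpos a b h).trans (hpos a _ (hd a)).symm
    exact hb (Fin.ext (hω.pow_inj b.2 (Fin.is_lt _)
      (mul_left_cancel₀ (pow_ne_zero N hω0) h2)))
  have hdiag : c.submatrix id (Equiv.addRight (b₀ - a₀)) =
      Matrix.diagonal fun a => c a (a + (b₀ - a₀)) := by
    ext1 a b
    by_cases hab : a = b
    · simp [hab]
    · rw [Matrix.diagonal_apply_ne _ hab, Matrix.submatrix_apply]
      exact huniq _ _ fun h => hab (add_right_cancel h).symm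
  have hdet : c.det ≠ 0 := by
    intro h
    have h2 := Matrix.det_permute' (Equiv.addRight (b₀ - a₀)) c
    rw [h, mul_zero, hdiag, Matrix.det_diagonal, Finset.prod_eq_zero_iff] at h2
    obtain ⟨a, -, ha⟩ := h2
    exact hd a ha
  rw [hrq, Matrix.det_smul]
  refine mul_ne_zero (pow_ne_zero _ (pow_ne_zero _ X_ne_zero)) fun h => hdet ?_
  rw [← hqc, ← RingHom.map_det, h, map_zero]

theorem eq_zero_of_det_eq_zero (hω : IsPrimitiveRoot ω n)
    {r : Matrix (Fin n) (Fin n) F[X][X]} (hr : r ∈ twistedAlgebra n ω) (h : r.det = 0) :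
    r = 0 := by
  by_contra h0
  exact det_ne_zero_of_mem_twistedAlgebra hω hr h0 h

omit [NeZero n] in
theorem pow_val_add (hω : IsPrimitiveRoot ω n) (a b : Fin n) :
    ω ^ ((a + b : Fin n) : ℕ) = ω ^ (a : ℕ) * ω ^ (b : ℕ) := by
  rw [Fin.val_add, ← pow_add, ← pow_mod_orderOf ω (a + b : ℕ), ← hω.eq_orderOf]

/-- On the cyclic diagonal `a - b = k`, interpolation at the distinct points `ω ^ b` encodes the
entries of `A` in one polynomial `g k`. The entry `g k (ω ^ b x) y ^ k` obeys both relations and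
specializes correctly at `(1, 1)`. -/
theorem exists_mem_twistedAlgebra (hω : IsPrimitiveRoot ω n) (A : Matrix (Fin n) (Fin n) F) :
    ∃ r ∈ twistedAlgebra n ω, (evalPoint 1 1).mapMatrix r = A := by
  classical
  have hinj : Set.InjOn (fun b : Fin n => ω ^ (b : ℕ)) (Finset.univ : Finset (Fin n)) :=
    fun a _ b _ h => Fin.ext (hω.pow_inj a.2 b.2 h)
  set g : Fin n → F[X] := fun k =>
    Lagrange.interpolate Finset.univ (fun b : Fin n => ω ^ (b : ℕ)) (fun b : Fin n => A (b + k) b) with hg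
  have hge : ∀ k b : Fin n, (g k).eval (ω ^ (b : ℕ)) = A (b + k) b := fun k b =>
    Lagrange.eval_interpolate_at_node (fun b : Fin n => A (b + k) b) hinj (Finset.mem_univ b)
  have h1 : ∀ b : Fin n, ω ^ ((b + 1 : Fin n) : ℕ) = ω * ω ^ (b : ℕ) := by
    intro b
    rw [Fin.val_add, ← pow_succ', ← pow_mod_orderOf ω (b + 1 : ℕ), ← hω.eq_orderOf,
      Fin.val_one', Nat.add_mod_mod]
  refine ⟨Matrix.of fun a b =>
    C ((g (a - b)).comp (C (ω ^ (b : ℕ)) * X)) * X ^ ((a - b : Fin n) : ℕ), ⟨?_, ?_⟩, ?_⟩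
  · ext1 a b
    simp only [Matrix.submatrix_apply, Equiv.coe_addRight, Matrix.of_apply, add_sub_add_right_eq_sub,
      AlgHom.mapMatrix_apply, Matrix.map_apply]
    rw [h1]
    ext1 m
    simp only [coeff_scaleInner, coeff_C_mul, coeff_X_pow, mul_ite, mul_one, mul_zero]
    split_ifs
    · rw [comp_assoc]
      congr 1
      rw [mul_comp, C_comp, X_comp, ← mul_assoc, ← C_mul, mul_comm ω]
    · simp
  · ext1 a b
    rw [Matrix.mul_diagonal, Matrix.diagonal_mul]
    simp only [Matrix.of_apply, AlgHom.mapMatrix_apply, Matrix.map_apply]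
    ext1 m
    simp only [coeff_scaleOuter, coeff_C_mul, coeff_mul_C, coeff_X_pow, mul_ite, mul_one, mul_zero]
    split_ifs with hm
    · have := pow_val_add hω (a - b) b
      rw [sub_add_cancel] at this
      rw [this, hm, smul_eq_C_mul, C_mul]
      ring
    · simp
  · ext a b
    simp [evalPoint_apply, hge]

end TwistedAlgebra

end NCPoly

namespace NCPoly

open Polynomial

/-! ### Values of `f` lifted to the twisted algebra: scalar powers and vanishing traces. -/

section Values

theorem map_freeAlgebra_lift {R A B ι : Type*} [CommSemiring R] [Semiring A] [Semiring B]
    [Algebra R A] [Algebra R B] (φ : A →ₐ[R] B) (a : ι → A) (f : FreeAlgebra R ι) :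
    φ (FreeAlgebra.lift R a f) = FreeAlgebra.lift R (fun i => φ (a i)) f := by
  have : φ.comp (FreeAlgebra.lift R a) = FreeAlgebra.lift R (fun i => φ (a i)) := by
    ext i
    simp
  exact DFunLike.congr_fun this f

theorem freeAlgebra_lift_mem {R A ι : Type*} [CommSemiring R] [Semiring A] [Algebra R A]
    (S : Subalgebra R A) {a : ι → A} (ha : ∀ i, a i ∈ S) (f : FreeAlgebra R ι) :
    FreeAlgebra.lift R a f ∈ S := by
  have h : FreeAlgebra.lift R a f = S.val (FreeAlgebra.lift R (fun i => (⟨a i, ha i⟩ : S)) f) :=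
    (map_freeAlgebra_lift S.val (fun i => (⟨a i, ha i⟩ : S)) f).symm
  exact h ▸ Subtype.prop _

theorem mapMatrix_smul_one {R A B ι : Type*} [CommSemiring R] [Semiring A] [Semiring B]
    [Algebra R A] [Algebra R B] [Fintype ι] [DecidableEq ι] (φ : A →ₐ[R] B) (u : A) :
    φ.mapMatrix (u • (1 : Matrix ι ι A)) = φ u • (1 : Matrix ι ι B) := by
  ext a b
  by_cases hab : a = b <;> simp [hab]

variable {F : Type*} [Field F] {n : ℕ} {d : ℕ}

/-- Every value of `f` on `M_n(F)` lifts to a value of `f` in the twisted algebra. -/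
theorem exists_lift_value [NeZero n] {ω : F} (hω : IsPrimitiveRoot ω n)
    (f : FreeAlgebra F (Fin d)) (a : Fin d → Matrix (Fin n) (Fin n) F) :
    ∃ r ∈ twistedAlgebra n ω, (evalPoint 1 1).mapMatrix r = FreeAlgebra.lift F a f ∧
      ∀ x y, (evalPoint x y).mapMatrix r ∈ image n f := by
  choose s hs hsa using fun i => exists_mem_twistedAlgebra hω (a i)
  refine ⟨FreeAlgebra.lift F s f, freeAlgebra_lift_mem _ hs f, ?_,
    fun x y => ⟨fun i => (evalPoint x y).mapMatrix (s i), ?_⟩⟩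
  · rw [map_freeAlgebra_lift]
    simp_rw [hsa]
  · rw [map_freeAlgebra_lift]

variable [IsAlgClosed F] [CharZero F]

theorem exists_primitiveRoot (F : Type*) [Field F] [IsAlgClosed F] [CharZero F] (n : ℕ)
    [NeZero n] : ∃ ω : F, IsPrimitiveRoot ω n := by
  have : NeZero (n : F) := ⟨Nat.cast_ne_zero.2 (NeZero.ne n)⟩
  exact HasEnoughRootsOfUnity.exists_primitiveRoot F n

/-- A polynomial which is not an identity takes an invertible value. -/
theorem exists_det_ne_zero [NeZero n] {f : FreeAlgebra F (Fin d)} (hf : ¬ IsIdentity n f) :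
    ∃ a : Fin d → Matrix (Fin n) (Fin n) F, (FreeAlgebra.lift F a f).det ≠ 0 := by
  obtain ⟨ω, hω⟩ := exists_primitiveRoot F n
  by_contra! h
  refine hf fun a => ?_
  obtain ⟨r, hr, hra, hrf⟩ := exists_lift_value hω f a
  rw [← hra, eq_zero_of_det_eq_zero hω hr, map_zero]
  refine eq_zero_of_evalPoint fun x y => ?_
  rw [AlgHom.map_det]
  obtain ⟨b, hb⟩ := hrf x y
  rw [hb, h]

theorem not_isIdentity_pow [NeZero n] {f : FreeAlgebra F (Fin d)} (hf : ¬ IsIdentity n f)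
    (m : ℕ) : ¬ IsIdentity n (f ^ m) := by
  obtain ⟨a, ha⟩ := exists_det_ne_zero hf
  intro h
  have h2 := congrArg Matrix.det (h a)
  rw [map_pow, Matrix.det_pow, Matrix.det_zero] at h2
  exact ha (eq_zero_of_pow_eq_zero h2)

omit [IsAlgClosed F] [CharZero F] in
theorem not_isIdentity_of_pow {f : FreeAlgebra F (Fin d)} {m : ℕ} (hm : 1 ≤ m)
    (h : ¬ IsIdentity n (f ^ m)) : ¬ IsIdentity n f := fun hf =>
  h fun a => by rw [map_pow, hf a, zero_pow (by omega)]

omit [CharZero F] in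
theorem exists_det_sub_smul_one [NeZero n] (A : Matrix (Fin n) (Fin n) F) :
    ∃ e : F, (A - e • (1 : Matrix (Fin n) (Fin n) F)).det = 0 := by
  obtain ⟨e, he⟩ := IsAlgClosed.exists_root A.charpoly (by
    rw [Matrix.charpoly_degree_eq_dim]
    simp [NeZero.ne n])
  refine ⟨e, ?_⟩
  rw [IsRoot.def, Matrix.eval_charpoly, Matrix.scalar_apply, ← Matrix.smul_one_eq_diagonal] at he
  rw [← neg_sub, Matrix.det_neg, he, mul_zero]

/-- If the values of `f` lie in finitely many similarity classes up to scalars, then `f ^ n` takes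
only scalar values. -/
theorem pow_scalar_of_finite [NeZero n] {f : FreeAlgebra F (Fin d)}
    {S : Set (Matrix (Fin n) (Fin n) F)} (hS : S.Finite) (hf : image n f ⊆ ⋃ a ∈ S, simScalar a)
    (a : Fin d → Matrix (Fin n) (Fin n) F) :
    ∃ c : F, FreeAlgebra.lift F a f ^ n = c • (1 : Matrix (Fin n) (Fin n) F) := by
  classical
  obtain ⟨ω, hω⟩ := exists_primitiveRoot F n
  have hω0 : ω ≠ 0 := hω.ne_zero (NeZero.ne n)
  -- Passing from `b` to `c • t b t⁻¹` multiplies both `b ^ n` and `det b` by `c ^ n`, up to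
  -- conjugation, so `e` works for the whole class of `b`.
  have hE : ∀ b : Matrix (Fin n) (Fin n) F, ∃ e : F, b.det ≠ 0 →
      (b ^ n - (e * b.det) • (1 : Matrix (Fin n) (Fin n) F)).det = 0 := by
    intro b
    obtain ⟨e, he⟩ := exists_det_sub_smul_one (b ^ n)
    refine ⟨e / b.det, fun hb => ?_⟩
    rwa [div_mul_cancel₀ _ hb]
  choose e he using hE
  -- The factor `A.det` takes care of the singular values, for which no ratio is available.
  have key : ∀ A ∈ image n f, A.det * ∏ x ∈ hS.toFinset.image e,
      (A ^ n - (x * A.det) • (1 : Matrix (Fin n) (Fin n) F)).det = 0 := by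
    intro A hA
    by_cases hdet : A.det = 0
    · rw [hdet, zero_mul]
    obtain ⟨b, hbS, c, t, hAt⟩ : ∃ b ∈ S, A ∈ simScalar b := by simpa using hf hA
    have hAdet : A.det = c ^ n * b.det := by
      rw [hAt, Matrix.det_smul, Matrix.det_units_conj, Fintype.card_fin]
    have hb : b.det ≠ 0 := fun h => hdet (by rw [hAdet, h, mul_zero])
    refine mul_eq_zero_of_right _ (Finset.prod_eq_zero
      (Finset.mem_image_of_mem e (hS.mem_toFinset.2 hbS)) ?_)
    have : A ^ n - (e b * A.det) • (1 : Matrix (Fin n) (Fin n) F) =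
        c ^ n • ((t : Matrix (Fin n) (Fin n) F) * (b ^ n - (e b * b.det) • 1) *
          (t⁻¹ : (Matrix (Fin n) (Fin n) F)ˣ).val) := by
      rw [hAdet, mul_sub, sub_mul, ← Units.conj_pow, mul_smul_comm, mul_one, smul_mul_assoc,
        Units.mul_inv, smul_sub, smul_smul, hAt, _root_.smul_pow, mul_left_comm]
    rw [this, Matrix.det_smul, Matrix.det_units_conj, he b hb, mul_zero]
  obtain ⟨r, hr, hra, hrf⟩ := exists_lift_value hω f a
  have hprod : r.det * ∏ x ∈ hS.toFinset.image e,
      (r ^ n - (x • r.det) • (1 : Matrix (Fin n) (Fin n) F[X][X])).det = 0 := by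
    refine eq_zero_of_evalPoint fun x y => ?_
    rw [← key _ (hrf x y), map_mul, map_prod, AlgHom.map_det]
    congr 1
    refine Finset.prod_congr rfl fun z _ => ?_
    rw [AlgHom.map_det, map_sub, map_pow, mapMatrix_smul_one, map_smul, AlgHom.map_det,
      smul_eq_mul]
  rw [← hra, ← map_pow]
  rcases mul_eq_zero.1 hprod with h | h
  · exact ⟨0, by rw [eq_zero_of_det_eq_zero hω hr h, zero_pow (NeZero.ne n), map_zero, zero_smul]⟩
  · obtain ⟨x, -, hx⟩ := Finset.prod_eq_zero_iff.1 h
    have hmem : r ^ n - (x • r.det) • 1 ∈ twistedAlgebra n ω := by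
      refine Subalgebra.sub_mem _ (Subalgebra.pow_mem _ hr n) ?_
      rw [smul_assoc]
      exact Subalgebra.smul_mem _ (det_smul_one_mem_twistedAlgebra hω0 hr) x
    rw [sub_eq_zero.1 (eq_zero_of_det_eq_zero hω hmem hx), mapMatrix_smul_one]
    exact ⟨_, rfl⟩

/-- The sums of `n` many `j`-th roots of unity. -/
noncomputable def sumsOfRoots (F : Type*) [Field F] (n j : ℕ) : Finset F :=
  open Classical in
  ((nthRoots j (1 : F)).toFinset.sym n).image
    fun s : Sym F n => (s : Multiset F).sum

omit [IsAlgClosed F] [CharZero F] in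
theorem sum_mem_sumsOfRoots {j : ℕ} (hj : 1 ≤ j) {s : Multiset F} (hs : s.card = n)
    (h : ∀ x ∈ s, x ^ j = 1) : s.sum ∈ sumsOfRoots F n j := by
  classical
  refine Finset.mem_image.2 ⟨Sym.mk s hs, Finset.mem_sym_iff.2 fun x hx => ?_, rfl⟩
  rw [Multiset.mem_toFinset, mem_nthRoots (by omega)]
  exact h x hx

/-- All eigenvalues are `j`-th roots of `c`, so for a nonzero eigenvalue `l` the trace is `l` times
a sum of `n` roots of unity. The point is that `k` ranges over a finite set independent of `A`. -/
theorem exists_trace_ratio [NeZero n] {j : ℕ} (hj : 1 ≤ j) {A : Matrix (Fin n) (Fin n) F} {c : F}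
    (hA : A ^ j = c • (1 : Matrix (Fin n) (Fin n) F)) :
    ∃ k ∈ sumsOfRoots F n j, (A.trace • (1 : Matrix (Fin n) (Fin n) F) - k • A).det = 0 := by
  have hroot : ∀ x ∈ A.charpoly.roots, (x • (1 : Matrix (Fin n) (Fin n) F) - A).det = 0 := by
    intro x hx
    have := (mem_roots'.1 hx).2
    rwa [IsRoot.def, Matrix.eval_charpoly, Matrix.scalar_apply, ← Matrix.smul_one_eq_diagonal]
      at this
  have hpow : ∀ x ∈ A.charpoly.roots, x ^ j = c := by
    intro x hx
    obtain ⟨v, hv, hAv⟩ := Matrix.exists_mulVec_eq_zero_iff.2 (hroot x hx)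
    rw [Matrix.sub_mulVec, Matrix.smul_mulVec, Matrix.one_mulVec, sub_eq_zero] at hAv
    have hp : ∀ m : ℕ, (A ^ m).mulVec v = x ^ m • v := by
      intro m
      induction m with
      | zero => simp
      | succ m ih => rw [pow_succ, ← Matrix.mulVec_mulVec, ← hAv, Matrix.mulVec_smul, ih, smul_smul,
          pow_succ']
    have := hp j
    rw [hA, Matrix.smul_mulVec, Matrix.one_mulVec] at this
    exact (smul_left_injective F hv this).symm
  have hcard : A.charpoly.roots.card = n := by
    rw [← (IsAlgClosed.splits A.charpoly).natDegree_eq_card_roots, Matrix.charpoly_natDegree_eq_dim,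
      Fintype.card_fin]
  obtain ⟨l, hl⟩ := Multiset.card_pos_iff_exists_mem.1 (hcard.symm ▸ NeZero.pos n)
  by_cases hl0 : l = 0
  · have hnil : IsNilpotent A :=
      ⟨j, by rw [hA, ← hpow l hl, hl0, zero_pow (by omega), zero_smul]⟩
    have htr : A.trace = 0 := (Matrix.isNilpotent_trace_of_isNilpotent hnil).eq_zero
    have hdet : A.det = 0 := by
      have := hroot l hl
      rw [hl0, zero_smul, zero_sub, Matrix.det_neg] at this
      simpa using this
    -- Here `A` is singular and traceless, so any `k` would do; the sum of `n` ones is taken.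
    refine ⟨_, sum_mem_sumsOfRoots hj (Multiset.card_replicate n 1)
      (fun x hx => by rw [Multiset.eq_of_mem_replicate hx, one_pow]), ?_⟩
    rw [htr, zero_smul, zero_sub, ← neg_smul, Matrix.det_smul, hdet, mul_zero]
  · refine ⟨_, sum_mem_sumsOfRoots hj (s := A.charpoly.roots.map (· / l))
      (by rw [Multiset.card_map, hcard]) ?_, ?_⟩
    · intro x hx
      obtain ⟨y, hy, rfl⟩ := Multiset.mem_map.1 hx
      rw [div_pow, hpow y hy, ← hpow l hl, div_self (pow_ne_zero _ hl0)]
    · rw [Matrix.trace_eq_sum_roots_charpoly, Multiset.sum_map_div, Multiset.map_id']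
      set t := A.charpoly.roots.sum
      have : t • (1 : Matrix (Fin n) (Fin n) F) - (t / l) • A = (t / l) • (l • 1 - A) := by
        rw [smul_sub, smul_smul, div_mul_cancel₀ _ hl0]
      rw [this, Matrix.det_smul, hroot l hl, mul_zero]

/-- If some power of `g` takes only scalar values, then each value of `g` is scalar or has
trace `0`. -/
theorem trace_eq_zero_or_scalar [NeZero n] {g : FreeAlgebra F (Fin d)} {j : ℕ} (hj : 1 ≤ j)
    (hg : ∀ A ∈ image n g, ∃ c : F, A ^ j = c • (1 : Matrix (Fin n) (Fin n) F))
    (a : Fin d → Matrix (Fin n) (Fin n) F) :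
    (FreeAlgebra.lift F a g).trace = 0 ∨
      ∃ c : F, FreeAlgebra.lift F a g = c • (1 : Matrix (Fin n) (Fin n) F) := by
  obtain ⟨ω, hω⟩ := exists_primitiveRoot F n
  have hω0 : ω ≠ 0 := hω.ne_zero (NeZero.ne n)
  obtain ⟨r, hr, hra, hrf⟩ := exists_lift_value hω g a
  have htr : ∀ x y, evalPoint x y r.trace = ((evalPoint x y).mapMatrix r).trace := fun x y => by
    simp [Matrix.trace]
  have hprod : ∏ k ∈ sumsOfRoots F n j,
      (r.trace • (1 : Matrix (Fin n) (Fin n) F[X][X]) - k • r).det = 0 := by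
    refine eq_zero_of_evalPoint fun x y => ?_
    obtain ⟨c, hc⟩ := hg _ (hrf x y)
    obtain ⟨k, hk, hk0⟩ := exists_trace_ratio hj hc
    rw [map_prod]
    refine Finset.prod_eq_zero hk ?_
    rw [AlgHom.map_det, map_sub, mapMatrix_smul_one, map_smul, htr, hk0]
  obtain ⟨k, -, hk⟩ := Finset.prod_eq_zero_iff.1 hprod
  have h := eq_zero_of_det_eq_zero hω (Subalgebra.sub_mem _
    (trace_smul_one_mem_twistedAlgebra hω0 hr) (Subalgebra.smul_mem _ hr k)) hk
  have h2 := congrArg (evalPoint 1 1).mapMatrix h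
  rw [map_sub, map_zero, mapMatrix_smul_one, map_smul, htr, hra, sub_eq_zero] at h2
  by_cases hk0 : k = 0
  · left
    rw [hk0, zero_smul] at h2
    simpa using congrFun (congrFun h2 0) 0
  · exact Or.inr ⟨k⁻¹ * (FreeAlgebra.lift F a g).trace, by
      rw [mul_smul, h2, smul_smul, inv_mul_cancel₀ hk0, one_smul]⟩

omit [CharZero F] in
-- Turns the pointwise alternative into a uniform one. On the line from `a₀` to `a`, an entry of a
-- commutator with a matrix unit times the trace is a polynomial in `t` that vanishes everywhere.
-- The commutator entry can be chosen nonzero, so the trace vanishes along the line, in particular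
-- at `t = 1`.
theorem trace_eq_zero_of_not_scalar {g : FreeAlgebra F (Fin d)}
    (hg : ∀ a : Fin d → Matrix (Fin n) (Fin n) F, (FreeAlgebra.lift F a g).trace = 0 ∨
      ∃ c : F, FreeAlgebra.lift F a g = c • (1 : Matrix (Fin n) (Fin n) F))
    {a₀ : Fin d → Matrix (Fin n) (Fin n) F}
    (ha₀ : ¬ ∃ c : F, FreeAlgebra.lift F a₀ g = c • (1 : Matrix (Fin n) (Fin n) F))
    (a : Fin d → Matrix (Fin n) (Fin n) F) : (FreeAlgebra.lift F a g).trace = 0 := by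
  obtain ⟨p, q, hpq⟩ : ∃ p q, ¬ Commute (Matrix.single p q 1) (FreeAlgebra.lift F a₀ g) := by
    by_contra! h
    obtain ⟨c, hc⟩ := Matrix.mem_range_scalar_of_commute_single (fun p q _ => h p q)
    exact ha₀ ⟨c, by rw [← hc, Matrix.scalar_apply, Matrix.smul_one_eq_diagonal]⟩
  set P : Matrix (Fin n) (Fin n) F[X] := FreeAlgebra.lift F
    (fun i => (a₀ i).map C + (X : F[X]) • (a i - a₀ i).map C) g with hP
  have hev : ∀ t : F, (aeval t).mapMatrix P =
      FreeAlgebra.lift F (fun i => a₀ i + t • (a i - a₀ i)) g := by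
    intro t
    rw [hP, map_freeAlgebra_lift]
    congr 2
    funext i
    ext u v
    simp
  set H : Matrix (Fin n) (Fin n) F[X] := Matrix.single p q 1 * P - P * Matrix.single p q 1 with hH
  have hHev : ∀ t : F, (aeval t).mapMatrix H =
      Matrix.single p q 1 * (aeval t).mapMatrix P - (aeval t).mapMatrix P * Matrix.single p q 1 := by
    intro t
    rw [hH, map_sub, map_mul, map_mul]
    have : (aeval t : F[X] →ₐ[F] F).mapMatrix (Matrix.single p q (1 : F[X])) =
        Matrix.single p q 1 := by
      rw [AlgHom.mapMatrix_apply, Matrix.map_single, map_one]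
    rw [this]
  have h0 : H ≠ 0 := by
    intro h
    have := hHev 0
    rw [h, map_zero, hev, eq_comm, sub_eq_zero] at this
    simp only [zero_smul, add_zero] at this
    exact hpq this
  obtain ⟨u, v, huv⟩ : ∃ u v, H u v ≠ 0 := by
    by_contra! h
    exact h0 (Matrix.ext h)
  have htr : ∀ t : F, aeval t P.trace = ((aeval t).mapMatrix P).trace := fun t => by
    simp [Matrix.trace]
  have hmul : H u v * P.trace = 0 := by
    refine Polynomial.funext fun t => ?_
    rw [← coe_aeval_eq_eval, map_mul, htr, map_zero, hev]
    rcases hg (fun i => a₀ i + t • (a i - a₀ i)) with h | ⟨c, hc⟩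
    · rw [h, mul_zero]
    · have := congrFun (congrFun (hHev t) u) v
      rw [hev, hc, mul_smul_comm, smul_mul_assoc, mul_one, one_mul, sub_self] at this
      rw [show aeval t (H u v) = 0 from this, zero_mul]
  have hz := htr 1
  rw [(mul_eq_zero.1 hmul).resolve_left huv, map_zero, hev] at hz
  simpa using hz.symm

/-- The traces of the powers `f(a) ^ i` with `0 < i < j` vanish if `f` is `j`-central. -/
theorem IsPowCentral.trace_pow_eq_zero [NeZero n] {f : FreeAlgebra F (Fin d)} {j : ℕ}
    (hf : IsPowCentral n j f) {i : ℕ} (hi : 1 ≤ i) (hij : i < j)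
    (a : Fin d → Matrix (Fin n) (Fin n) F) : (FreeAlgebra.lift F a f ^ i).trace = 0 := by
  obtain ⟨hj, ⟨hsc, hid⟩, hmin⟩ := hf
  have hni := hmin i hi hij
  -- Powers of a nonidentity are nonidentities, so `f ^ i` can fail to be central only by having a
  -- nonscalar value.
  have hna : ¬ ∀ a : Fin d → Matrix (Fin n) (Fin n) F, ∃ c : F,
      FreeAlgebra.lift F a (f ^ i) = c • (1 : Matrix (Fin n) (Fin n) F) :=
    fun h => hni ⟨h, not_isIdentity_pow (not_isIdentity_of_pow hj hid) i⟩
  push Not at hna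
  obtain ⟨a₀, ha₀⟩ := hna
  rw [← map_pow]
  refine trace_eq_zero_of_not_scalar (trace_eq_zero_or_scalar hj ?_)
    (a₀ := a₀) (by simpa using ha₀) a
  rintro _ ⟨b, rfl⟩
  obtain ⟨c, hc⟩ := hsc b
  refine ⟨c ^ i, ?_⟩
  rw [← map_pow, ← pow_mul, mul_comm, pow_mul, map_pow, hc, _root_.smul_pow, one_pow]

end Values

end NCPoly

namespace NCPoly

/-! ### Similarity from a change of basis. -/

section Similarity

variable {F : Type*} [Field F] {n : ℕ}

theorem exists_conj_of_basis {A B : Matrix (Fin n) (Fin n) F}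
    (b : Module.Basis (Fin n) F (Fin n → F)) (h : ∀ q, A.mulVec (b q) = ∑ p, B p q • b p) :
    ∃ t : (Matrix (Fin n) (Fin n) F)ˣ,
      A = t * B * ((t⁻¹ : (Matrix (Fin n) (Fin n) F)ˣ) : Matrix (Fin n) (Fin n) F) := by
  set T := (Pi.basisFun F (Fin n)).toMatrix b with hT
  have hTb : ∀ p q, T p q = b q p := fun p q => by simp [hT, Module.Basis.toMatrix_apply]
  have : Invertible T := (Pi.basisFun F (Fin n)).invertibleToMatrix b
  have hAT : A * T = T * B := by
    ext p q
    have := congrFun (h q) p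
    simp only [Matrix.mulVec, dotProduct, Finset.sum_apply, Pi.smul_apply, smul_eq_mul] at this
    simp only [Matrix.mul_apply, hTb, this, mul_comm]
  refine ⟨unitOfInvertible T, ?_⟩
  rw [val_unitOfInvertible, ← hAT, val_inv_unitOfInvertible, mul_assoc, mul_invOf_self, mul_one]

end Similarity

/-! ### Matrices of finite order with traceless powers. -/

section FiniteOrder

variable {F : Type*} [Field F] [CharZero F] {n j : ℕ} {μ : F}

/-- The projection onto the eigenspace of `A` for a `j`-th root of unity `ν`, if `A ^ j = 1`. -/
noncomputable def eigenProj (A : Matrix (Fin n) (Fin n) F) (j : ℕ) (ν : F) :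
    Matrix (Fin n) (Fin n) F :=
  (j : F)⁻¹ • ∑ i ∈ Finset.range j, (ν⁻¹ • A) ^ i

omit [CharZero F] in
theorem mul_eigenProj {A : Matrix (Fin n) (Fin n) F} (hA : A ^ j = 1) {ν : F} (hν : ν ^ j = 1)
    (hν0 : ν ≠ 0) : A * eigenProj A j ν = ν • eigenProj A j ν := by
  have h : (ν⁻¹ • A - 1) * ∑ i ∈ Finset.range j, (ν⁻¹ • A) ^ i = 0 := by
    rw [mul_geom_sum, smul_pow, hA, inv_pow, hν, inv_one, one_smul, sub_self]
  rw [sub_mul, one_mul, sub_eq_zero, smul_mul_assoc, inv_smul_eq_iff₀ hν0] at h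
  rw [eigenProj, mul_smul_comm, h, smul_comm]

theorem eigenProj_mulVec (hj : 1 ≤ j) {A : Matrix (Fin n) (Fin n) F} {ν : F} (hν0 : ν ≠ 0)
    {v : Fin n → F} (hv : A.mulVec v = ν • v) : (eigenProj A j ν).mulVec v = v := by
  have hp : ∀ i : ℕ, ((ν⁻¹ • A) ^ i).mulVec v = v := by
    intro i
    induction i with
    | zero => simp
    | succ i ih => rw [pow_succ, ← Matrix.mulVec_mulVec, Matrix.smul_mulVec, hv, smul_smul,
        inv_mul_cancel₀ hν0, one_smul, ih]
  rw [eigenProj, Matrix.smul_mulVec, Matrix.sum_mulVec, Finset.sum_congr rfl fun i _ => hp i,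
    Finset.sum_const, Finset.card_range, ← Nat.cast_smul_eq_nsmul F, smul_smul,
    inv_mul_cancel₀ (Nat.cast_ne_zero.2 (by omega)), one_smul]

/-- Orthogonality of the `j`-th roots of unity kills every power of `A` except the zeroth. -/
theorem sum_eigenProj (hj : 1 ≤ j) (hμ : IsPrimitiveRoot μ j) (A : Matrix (Fin n) (Fin n) F) :
    ∑ l : Fin j, eigenProj A j (μ ^ (l : ℕ)) = 1 := by
  have hi : ∀ i ∈ Finset.range j, ∑ l : Fin j, ((μ ^ (l : ℕ))⁻¹ • A) ^ i =
      if i = 0 then (j : F) • (1 : Matrix (Fin n) (Fin n) F) else 0 := by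
    intro i hi
    split_ifs with h0
    · subst h0
      simp [Nat.cast_smul_eq_nsmul]
    · have hne : (μ⁻¹) ^ i ≠ 1 := by
        rw [inv_pow, Ne, inv_eq_one]
        exact hμ.pow_ne_one_of_pos_of_lt h0 (Finset.mem_range.1 hi)
      have hz : ∑ l ∈ Finset.range j, ((μ⁻¹) ^ i) ^ l = 0 := by
        refine (mul_eq_zero.1 (mul_geom_sum ((μ⁻¹) ^ i) j |>.trans ?_)).resolve_left
          (sub_ne_zero.2 hne)
        rw [← pow_mul, mul_comm, pow_mul, inv_pow, hμ.pow_eq_one, inv_one, one_pow, sub_self]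
      rw [Fin.sum_univ_eq_sum_range (fun l => ((μ ^ l)⁻¹ • A) ^ i)]
      have : ∀ l, ((μ ^ l)⁻¹ • A) ^ i = (((μ⁻¹) ^ i) ^ l) • A ^ i := by
        intro l
        rw [smul_pow, ← inv_pow, ← pow_mul, ← pow_mul, mul_comm]
      simp_rw [this]
      rw [← Finset.sum_smul, hz, zero_smul]
  simp_rw [eigenProj]
  rw [← Finset.smul_sum, Finset.sum_comm, Finset.sum_congr rfl hi, Finset.sum_ite_eq',
    if_pos (Finset.mem_range.2 (by omega)), smul_smul,
    inv_mul_cancel₀ (Nat.cast_ne_zero.2 (by omega)), one_smul]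

omit [CharZero F] in
theorem trace_eigenProj (hj : 1 ≤ j) {A : Matrix (Fin n) (Fin n) F}
    (htr : ∀ i, 1 ≤ i → i < j → (A ^ i).trace = 0) (ν : F) :
    (eigenProj A j ν).trace = n / j := by
  rw [eigenProj, Matrix.trace_smul, Matrix.trace_sum, Finset.sum_eq_single_of_mem 0
    (Finset.mem_range.2 (by omega))]
  · simp [div_eq_inv_mul]
  · intro i hi h0
    rw [smul_pow, Matrix.trace_smul, htr i (by omega) (Finset.mem_range.1 hi), smul_zero]

open Module.End in
-- The dimension is the trace of the projection `eigenProj`, to which only the term `i = 0`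
-- contributes.
theorem finrank_eigenspace (hj : 1 ≤ j) {A : Matrix (Fin n) (Fin n) F} (hA : A ^ j = 1)
    (htr : ∀ i, 1 ≤ i → i < j → (A ^ i).trace = 0) {ν : F} (hν : ν ^ j = 1) :
    (j * Module.finrank F (eigenspace (Matrix.toLin' A) ν) : ℕ) = n := by
  have hν0 : ν ≠ 0 := by
    rintro rfl
    rw [zero_pow (by omega)] at hν
    exact zero_ne_one hν
  have hproj : LinearMap.IsProj (eigenspace (Matrix.toLin' A) ν)
      (Matrix.toLin' (eigenProj A j ν)) := by
    refine ⟨fun v => ?_, fun v hv => ?_⟩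
    · rw [mem_eigenspace_iff, Matrix.toLin'_apply, Matrix.toLin'_apply, Matrix.mulVec_mulVec,
        mul_eigenProj hA hν hν0, Matrix.smul_mulVec]
    · rw [mem_eigenspace_iff, Matrix.toLin'_apply] at hv
      rw [Matrix.toLin'_apply, eigenProj_mulVec hj hν0 hv]
  have h := hproj.trace
  rw [Matrix.trace_toLin'_eq, trace_eigenProj hj htr,
    div_eq_iff (Nat.cast_ne_zero.2 (by omega)), mul_comm] at h
  exact_mod_cast h.symm

open Module.End in
theorem isInternal_eigenspace (hj : 1 ≤ j) (hμ : IsPrimitiveRoot μ j)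
    {A : Matrix (Fin n) (Fin n) F} (hA : A ^ j = 1) :
    DirectSum.IsInternal fun l : Fin j => eigenspace (Matrix.toLin' A) (μ ^ (l : ℕ)) := by
  have hroot : ∀ l : ℕ, (μ ^ l) ^ j = 1 := fun l => by
    rw [← pow_mul, mul_comm, pow_mul, hμ.pow_eq_one, one_pow]
  have hμ0 : μ ≠ 0 := hμ.ne_zero (by omega)
  refine DirectSum.isInternal_submodule_of_iSupIndep_of_iSup_eq_top
    ((eigenspaces_iSupIndep (Matrix.toLin' A)).comp
      (fun l m h => Fin.ext (hμ.pow_inj l.2 m.2 h))) ?_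
  rw [eq_top_iff]
  intro v _
  have hv : v = ∑ l : Fin j, (eigenProj A j (μ ^ (l : ℕ))).mulVec v := by
    rw [← Matrix.sum_mulVec, sum_eigenProj hj hμ, Matrix.one_mulVec]
  rw [hv]
  refine Submodule.sum_mem _ fun l _ => Submodule.mem_iSup_of_mem l ?_
  rw [mem_eigenspace_iff, Matrix.toLin'_apply, Matrix.mulVec_mulVec,
    mul_eigenProj hA (hroot l) (pow_ne_zero _ hμ0), Matrix.smul_mulVec]

/-- Matches the ordering of the eigenbasis with the blocks on the diagonal of `w`. -/
theorem finProdFinEquiv_div {j r n : ℕ} (hn : j * r = n) (hj : 1 ≤ j) (p : Fin j × Fin r) :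
    ((finCongr hn (finProdFinEquiv p) : Fin n) : ℕ) / (n / j) = p.1 := by
  have hr : n / j = r := by rw [← hn, Nat.mul_div_cancel_left _ (by omega)]
  rw [hr, finCongr_apply_coe, finProdFinEquiv_apply_val,
    Nat.add_mul_div_left _ _ (by have := p.2.2; omega), Nat.div_eq_of_lt p.2.2, zero_add]

open Module.End in
theorem exists_eigenbasis (hj : 1 ≤ j) (hμ : IsPrimitiveRoot μ j)
    {A : Matrix (Fin n) (Fin n) F} (hA : A ^ j = 1) {r : ℕ}
    (hfin : ∀ l : Fin j, Module.finrank F (eigenspace (Matrix.toLin' A) (μ ^ (l : ℕ))) = r) :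
    ∃ b : Module.Basis (Σ _ : Fin j, Fin r) F (Fin n → F),
      ∀ p, A.mulVec (b p) = μ ^ (p.1 : ℕ) • b p :=
  ⟨(isInternal_eigenspace hj hμ hA).collectedBasis fun l => Module.finBasisOfFinrankEq F _ (hfin l),
    fun p => mem_eigenspace_iff.1 ((isInternal_eigenspace hj hμ hA).collectedBasis_mem _ p)⟩

open Module.End in
/-- A matrix of order dividing `j` whose powers of exponent `0 < i < j` have trace `0` is similar
to `w n j μ`. -/
theorem similar_w (hj : 1 ≤ j) (hμ : IsPrimitiveRoot μ j) {A : Matrix (Fin n) (Fin n) F}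
    (hA : A ^ j = 1) (htr : ∀ i, 1 ≤ i → i < j → (A ^ i).trace = 0) :
    ∃ t : (Matrix (Fin n) (Fin n) F)ˣ,
      A = t * w n j μ * ((t⁻¹ : (Matrix (Fin n) (Fin n) F)ˣ) : Matrix (Fin n) (Fin n) F) := by
  have hroot : ∀ l : ℕ, (μ ^ l) ^ j = 1 := fun l => by
    rw [← pow_mul, mul_comm, pow_mul, hμ.pow_eq_one, one_pow]
  have hfin : ∀ l : Fin j,
      Module.finrank F (eigenspace (Matrix.toLin' A) (μ ^ (l : ℕ))) = n / j :=
    fun l => (Nat.div_eq_of_eq_mul_right (by omega)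
      (finrank_eigenspace hj hA htr (hroot l)).symm).symm
  have hn : j * (n / j) = n :=
    Nat.mul_div_cancel' ⟨_, (finrank_eigenspace hj hA htr (hroot 0)).symm⟩
  obtain ⟨b₀, hb₀⟩ := exists_eigenbasis hj hμ hA hfin
  refine exists_conj_of_basis (((b₀.reindex (Equiv.sigmaEquivProd _ _)).reindex
    finProdFinEquiv).reindex (finCongr hn)) fun i => ?_
  obtain ⟨p, rfl⟩ := (finCongr hn).surjective i
  obtain ⟨p, rfl⟩ := finProdFinEquiv.surjective p
  simp only [w, Matrix.diagonal_apply, ite_smul, zero_smul, Finset.sum_ite_eq', Finset.mem_univ,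
    if_true, finProdFinEquiv_div hn hj]
  simp only [Module.Basis.reindex_apply, Equiv.symm_apply_apply]
  exact hb₀ _

end FiniteOrder

end NCPoly

namespace NCPoly

open Polynomial

/-! ### Finitely many similarity classes of nilpotent matrices. -/

section Nilpotent

variable {F : Type*} [Field F]

/-- The monomial basis is a single Jordan block: `X` shifts each monomial to the next and kills the
last. -/
theorem exists_basis_quotient_X_pow (k : ℕ) :
    ∃ b : Module.Basis (Fin k) F (F[X] ⧸ (Submodule.span F[X] {(X : F[X]) ^ k})),
      ∀ s, (X : F[X]) • b s = 0 ∨ ∃ s', (X : F[X]) • b s = b s' := by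
  set pb := AdjoinRoot.powerBasis' (monic_X_pow (R := F) k)
  have hdim : pb.dim = k := by simp [pb]
  have hgen : pb.gen = AdjoinRoot.root (X ^ k) := AdjoinRoot.powerBasis'_gen _
  set b : Module.Basis (Fin k) F (F[X] ⧸ (Submodule.span F[X] {(X : F[X]) ^ k})) :=
    pb.basis.reindex (finCongr hdim)
  have hb : ∀ s : Fin k, b s = Submodule.Quotient.mk ((X : F[X]) ^ (s : ℕ)) := by
    intro s
    have h : pb.basis.reindex (finCongr hdim) s = AdjoinRoot.root (X ^ k) ^ (s : ℕ) := by
      rw [Module.Basis.reindex_apply, PowerBasis.basis_eq_pow, hgen]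
      rfl
    rw [AdjoinRoot.root, ← map_pow] at h
    exact h
  refine ⟨b, fun s => ?_⟩
  simp_rw [hb, ← Submodule.Quotient.mk_smul, smul_eq_mul, ← pow_succ']
  by_cases hs : (s : ℕ) + 1 < k
  · exact Or.inr ⟨⟨s + 1, hs⟩, rfl⟩
  · left
    rw [show (s : ℕ) + 1 = k by omega, Submodule.Quotient.mk_eq_zero]
    exact Submodule.mem_span_singleton_self _

theorem dfinsupp_basis_apply {ι R : Type*} {M : ι → Type*} {η : ι → Type*} [DecidableEq ι]
    [Semiring R] [∀ i, AddCommMonoid (M i)] [∀ i, Module R (M i)]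
    (b : ∀ i, Module.Basis (η i) R (M i)) (p : Σ i, η i) :
    DFinsupp.basis b p = DFinsupp.single p.1 (b p.1 p.2) := by
  classical
  apply (DFinsupp.mapRange.linearEquiv fun i => (b i).repr).injective
  rw [← (sigmaFinsuppLequivDFinsupp R).symm.injective.eq_iff]
  change (DFinsupp.basis b).repr (DFinsupp.basis b p) = _
  rw [Module.Basis.repr_self, LinearEquiv.eq_symm_apply]
  simp [DFinsupp.mapRange_single]

/-- A nilpotent endomorphism has a basis each of whose members it maps to a member or to `0`. -/
theorem exists_basis_of_isNilpotent {n : ℕ} {A : Matrix (Fin n) (Fin n) F} (hA : IsNilpotent A) :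
    ∃ b : Module.Basis (Fin n) F (Fin n → F),
      ∀ i, A.mulVec (b i) = 0 ∨ ∃ i', A.mulVec (b i) = b i' := by
  set φ := Matrix.toLin' A with hφ
  obtain ⟨m, hm⟩ := hA
  -- With `X` acting as `A`, the space is an `X`-power torsion `F[X]`-module, hence a direct sum of
  -- cyclic modules `F[X] / (X ^ k i)`.
  have htors : Module.IsTorsion' (Module.AEval' φ) (Submonoid.powers (X : F[X])) := by
    intro x
    obtain ⟨v, rfl⟩ := (Module.AEval'.of φ).surjective x
    refine ⟨⟨X ^ m, m, rfl⟩, ?_⟩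
    change (X : F[X]) ^ m • Module.AEval'.of φ v = 0
    rw [Module.AEval'.X_pow_smul_of, hφ, ← Matrix.toLin'_pow, hm, map_zero, zero_smul, map_zero]
  obtain ⟨d, k, ⟨e⟩⟩ := Module.torsion_by_prime_power_decomposition irreducible_X htors
  choose b hb using fun i : Fin d => exists_basis_quotient_X_pow (F := F) (k i)
  set E : (Fin n → F) ≃ₗ[F] (Π₀ i : Fin d, F[X] ⧸ (Submodule.span F[X] {(X : F[X]) ^ k i})) :=
    (Module.AEval'.of φ).trans (e.restrictScalars F) with hE
  have hEX : ∀ v, E (A.mulVec v) = (X : F[X]) • E v := by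
    intro v
    have : E (A.mulVec v) = e (Module.AEval'.of φ (φ v)) := rfl
    rw [this, ← Module.AEval'.X_smul_of, map_smul]
    rfl
  set B := (DFinsupp.basis b).map E.symm with hB
  have hBs : ∀ p, E (B p) = DFinsupp.single p.1 (b p.1 p.2) := by
    intro p
    rw [hB, Module.Basis.map_apply, LinearEquiv.apply_symm_apply]
    exact dfinsupp_basis_apply b p
  have hBX : ∀ p, A.mulVec (B p) = 0 ∨ ∃ p', A.mulVec (B p) = B p' := by
    intro p
    simp_rw [← E.injective.eq_iff, hEX, hBs, map_zero]
    rcases hb p.1 p.2 with h | ⟨s, h⟩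
    · left
      rw [← DFinsupp.single_smul, h, DFinsupp.single_zero]
    · right
      exact ⟨⟨p.1, s⟩, by rw [← DFinsupp.single_smul, h]⟩
  have hcard : Fintype.card (Σ i, Fin (k i)) = Fintype.card (Fin n) := by
    rw [← Module.finrank_eq_card_basis B, Module.finrank_fintype_fun_eq_card]
  refine ⟨B.reindex (Fintype.equivOfCardEq hcard), fun i => ?_⟩
  simp only [Module.Basis.reindex_apply]
  rcases hBX ((Fintype.equivOfCardEq hcard).symm i) with h | ⟨p, h⟩
  · exact Or.inl h
  · exact Or.inr ⟨Fintype.equivOfCardEq hcard p, by rw [h, Equiv.symm_apply_apply]⟩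

/-- Every nilpotent matrix is similar to a matrix with entries `0` and `1`. -/
theorem exists_similar_zero_one {n : ℕ} {A : Matrix (Fin n) (Fin n) F} (hA : IsNilpotent A) :
    ∃ (B : Matrix (Fin n) (Fin n) F) (t : (Matrix (Fin n) (Fin n) F)ˣ),
      (∀ i i', B i i' ∈ ({0, 1} : Set F)) ∧
      A = t * B * ((t⁻¹ : (Matrix (Fin n) (Fin n) F)ˣ) : Matrix (Fin n) (Fin n) F) := by
  classical
  obtain ⟨b, hb⟩ := exists_basis_of_isNilpotent hA
  refine ⟨LinearMap.toMatrix b b (Matrix.toLin' A), ?_⟩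
  obtain ⟨t, ht⟩ := exists_conj_of_basis (A := A) (B := LinearMap.toMatrix b b (Matrix.toLin' A)) b
    fun q => by simp only [LinearMap.toMatrix_apply, b.sum_repr, Matrix.toLin'_apply]
  refine ⟨t, fun p q => ?_, ht⟩
  rw [LinearMap.toMatrix_apply, Matrix.toLin'_apply]
  rcases hb q with h | ⟨q', h⟩
  · simp [h]
  · rw [h, Module.Basis.repr_self, Finsupp.single_apply]
    split_ifs <;> simp

theorem finite_nilpotent_representatives (F : Type*) [Field F] (n : ℕ) :
    ∃ N : Set (Matrix (Fin n) (Fin n) F), N.Finite ∧ (∀ a ∈ N, IsNilpotent a) ∧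
      ∀ A : Matrix (Fin n) (Fin n) F, IsNilpotent A → A ∈ ⋃ a ∈ N, simScalar a := by
  refine ⟨{B | (∀ i i', B i i' ∈ ({0, 1} : Set F)) ∧ IsNilpotent B}, ?_, fun a ha => ha.2, ?_⟩
  · have h01 : ({0, 1} : Set F).Finite := Set.toFinite _
    exact (Set.Finite.pi' fun _ : Fin n => Set.Finite.pi' fun _ : Fin n => h01).subset
      fun B hB => hB.1
  · intro A hA
    obtain ⟨B, t, hB, hAt⟩ := exists_similar_zero_one hA
    have hBn : IsNilpotent B := by
      obtain ⟨m, hm⟩ := hA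
      refine ⟨m, ?_⟩
      rwa [hAt, Units.conj_pow, Units.mul_left_eq_zero, Units.mul_right_eq_zero] at hm
    refine Set.mem_biUnion (show B ∈ _ from ⟨hB, hBn⟩) ⟨1, t, ?_⟩
    rw [one_smul, hAt]

end Nilpotent
end NCPoly

namespace NCPoly

/-! ### Finite and `j`-central polynomials: assembling the results. -/

section PowCentral

variable {F : Type*} [Field F] {n d : ℕ}

theorem isIdentity_iff_image {f : FreeAlgebra F (Fin d)} : IsIdentity n f ↔ image n f = {0} := by
  refine ⟨fun h => Set.eq_singleton_iff_unique_mem.2 ⟨⟨0, (h 0).symm⟩, ?_⟩, fun h a => ?_⟩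
  · rintro _ ⟨a, rfl⟩
    exact h a
  · have : FreeAlgebra.lift F a f ∈ image n f := ⟨a, rfl⟩
    rwa [h] at this

/-- Conjugation is an algebra endomorphism, so it commutes with evaluating `f`. This puts a multiple
of `w n j μ` itself, not just of a conjugate, in the image. -/
theorem conj_mem_image {f : FreeAlgebra F (Fin d)} {A : Matrix (Fin n) (Fin n) F}
    (hA : A ∈ image n f) (t : (Matrix (Fin n) (Fin n) F)ˣ) :
    ((t⁻¹ : (Matrix (Fin n) (Fin n) F)ˣ) : Matrix (Fin n) (Fin n) F) * A * t ∈ image n f := by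
  obtain ⟨a, rfl⟩ := hA
  let φ : Matrix (Fin n) (Fin n) F →ₐ[F] Matrix (Fin n) (Fin n) F :=
    AlgHom.ofLinearMap
      ((LinearMap.mulRight F (t : Matrix (Fin n) (Fin n) F)).comp
        (LinearMap.mulLeft F ((t⁻¹ : (Matrix (Fin n) (Fin n) F)ˣ) : Matrix (Fin n) (Fin n) F)))
      (by simp) (fun x y => by simp [mul_assoc])
  exact ⟨fun i => φ (a i), map_freeAlgebra_lift φ a f⟩

theorem zero_mem_simScalar (a : Matrix (Fin n) (Fin n) F) : 0 ∈ simScalar a :=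
  ⟨0, 1, by rw [zero_smul]⟩

theorem w_pow_eq_one {j : ℕ} {μ : F} (hμ : IsPrimitiveRoot μ j) : w n j μ ^ j = 1 := by
  rw [w, Matrix.diagonal_pow, ← Matrix.diagonal_one]
  congr 1
  funext i
  rw [Pi.pow_apply, ← pow_mul, mul_comm, pow_mul, hμ.pow_eq_one, one_pow]

theorem image_pow (f : FreeAlgebra F (Fin d)) (m : ℕ) :
    image n (f ^ m) = (· ^ m) '' image n f := by
  ext A
  constructor
  · rintro ⟨a, rfl⟩
    exact ⟨_, ⟨a, rfl⟩, (map_pow _ _ _).symm⟩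
  · rintro ⟨_, ⟨a, rfl⟩, rfl⟩
    exact ⟨a, (map_pow _ _ _).symm⟩

variable [IsAlgClosed F] [CharZero F]

theorem exists_isPowCentral_of_isFiniteOn [NeZero n] {f : FreeAlgebra F (Fin d)}
    (hf : IsFiniteOn n f) : ∃ j, IsPowCentral n j f := by
  classical
  obtain ⟨hne, S, hS, hsub⟩ := hf
  have hex : ∃ j, 1 ≤ j ∧ IsCentral n (f ^ j) := by
    refine ⟨n, NeZero.one_le, fun a => ?_,
      not_isIdentity_pow (fun h => hne (isIdentity_iff_image.1 h)) n⟩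
    rw [map_pow]
    exact pow_scalar_of_finite hS hsub a
  exact ⟨Nat.find hex, (Nat.find_spec hex).1, (Nat.find_spec hex).2,
    fun i hi hij h => Nat.find_min hex hij ⟨hi, h⟩⟩

/-- A value `A` of a `j`-central polynomial satisfies `A ^ j = 0`, or `c⁻¹ A` has order dividing
`j` and its powers of exponent `0 < i < j` have trace `0`. -/
theorem IsPowCentral.normalize [NeZero n] {f : FreeAlgebra F (Fin d)} {j : ℕ}
    (hf : IsPowCentral n j f) {A : Matrix (Fin n) (Fin n) F} (hA : A ∈ image n f) :
    A ^ j = 0 ∨ ∃ (c : F) (B : Matrix (Fin n) (Fin n) F), c ≠ 0 ∧ A = c • B ∧ B ^ j = 1 ∧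
      ∀ i, 1 ≤ i → i < j → (B ^ i).trace = 0 := by
  obtain ⟨a, rfl⟩ := hA
  obtain ⟨z, hz⟩ := hf.2.1.1 a
  rw [map_pow] at hz
  by_cases hz0 : z = 0
  · left
    rw [hz, hz0, zero_smul]
  right
  have hj : 0 < j := hf.1
  obtain ⟨c, rfl⟩ := IsAlgClosed.exists_pow_nat_eq z hj
  have hc : c ≠ 0 := by
    rintro rfl
    exact hz0 (zero_pow hj.ne')
  refine ⟨c, c⁻¹ • FreeAlgebra.lift F a f, hc, (smul_inv_smul₀ hc _).symm, ?_, fun i hi hij => ?_⟩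
  · rw [smul_pow, hz, smul_smul, ← mul_pow, inv_mul_cancel₀ hc, one_pow, one_smul]
  · rw [smul_pow, Matrix.trace_smul, hf.trace_pow_eq_zero hi hij, smul_zero]

omit [IsAlgClosed F] [CharZero F] in
theorem IsPowCentral.exists_pow_ne_zero [NeZero n] {f : FreeAlgebra F (Fin d)} {j : ℕ}
    (hf : IsPowCentral n j f) : ∃ A ∈ image n f, A ^ j ≠ 0 := by
  have h := hf.2.1.2
  simp only [IsIdentity, not_forall, map_pow] at h
  obtain ⟨a, ha⟩ := h
  exact ⟨_, ⟨a, rfl⟩, ha⟩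

theorem IsPowCentral.dvd [NeZero n] {f : FreeAlgebra F (Fin d)} {j : ℕ}
    (hf : IsPowCentral n j f) : j ∣ n := by
  obtain ⟨A, hA, hA0⟩ := hf.exists_pow_ne_zero
  obtain ⟨c, B, -, -, hB, htr⟩ := (hf.normalize hA).resolve_left hA0
  exact ⟨_, (finrank_eigenspace hf.1 hB htr (one_pow j)).symm⟩

theorem IsPowCentral.similar [NeZero n] {f : FreeAlgebra F (Fin d)} {j : ℕ}
    (hf : IsPowCentral n j f) {μ : F} (hμ : IsPrimitiveRoot μ j)
    {A : Matrix (Fin n) (Fin n) F} (hA : A ∈ image n f) :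
    A ^ j = 0 ∨ ∃ (c : F) (t : (Matrix (Fin n) (Fin n) F)ˣ), c ≠ 0 ∧ A = c •
      (t * w n j μ * ((t⁻¹ : (Matrix (Fin n) (Fin n) F)ˣ) : Matrix (Fin n) (Fin n) F)) := by
  refine (hf.normalize hA).imp_right ?_
  rintro ⟨c, B, hc, rfl, hB, htr⟩
  obtain ⟨t, ht⟩ := similar_w hf.1 hμ hB htr
  exact ⟨c, t, hc, by rw [← ht]⟩

theorem IsPowCentral.image_subset [NeZero n] {f : FreeAlgebra F (Fin d)} {j : ℕ}
    (hf : IsPowCentral n j f) {μ : F} (hμ : IsPrimitiveRoot μ j) :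
    ∃ N : Set (Matrix (Fin n) (Fin n) F), N.Finite ∧ (∀ a ∈ N, IsNilpotent a) ∧
      image n f ⊆ simScalar (w n j μ) ∪ ⋃ a ∈ N, simScalar a := by
  obtain ⟨N, hN, hnil, hcov⟩ := finite_nilpotent_representatives F n
  refine ⟨N, hN, hnil, fun A hA => ?_⟩
  rcases hf.similar hμ hA with h | ⟨c, t, -, h⟩
  · exact Or.inr (hcov A ⟨j, h⟩)
  · exact Or.inl ⟨c, t, h⟩

theorem IsPowCentral.isFiniteOn [NeZero n] {f : FreeAlgebra F (Fin d)} {j : ℕ}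
    (hf : IsPowCentral n j f) : IsFiniteOn n f := by
  have : NeZero j := ⟨by have := hf.1; omega⟩
  obtain ⟨μ, hμ⟩ := exists_primitiveRoot F j
  obtain ⟨N, hN, -, hsub⟩ := hf.image_subset hμ
  refine ⟨fun h => not_isIdentity_of_pow hf.1 hf.2.1.2 (isIdentity_iff_image.2 h),
    insert (w n j μ) N, hN.insert _, ?_⟩
  rwa [Set.biUnion_insert]

theorem IsPowCentral.image_pow_subset [NeZero n] {f : FreeAlgebra F (Fin d)} {j : ℕ}
    (hf : IsPowCentral n j f) {μ : F} (hμ : IsPrimitiveRoot μ j) {m : ℕ} (hm : j ≤ m) :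
    image n (f ^ m) ⊆ simScalar (w n j μ ^ m) := by
  rw [image_pow]
  rintro _ ⟨A, hA, rfl⟩
  rcases hf.similar hμ hA with h | ⟨c, t, -, rfl⟩
  -- The assumption `j ≤ m` matters here: it makes the `m`-th powers of nilpotent values vanish.
  · simp only [pow_eq_zero_of_le hm h, zero_mem_simScalar]
  · exact ⟨c ^ m, t, by simp only [smul_pow, Units.conj_pow]⟩

theorem IsPowCentral.exists_smul_w_pow_mem [NeZero n] {f : FreeAlgebra F (Fin d)} {j : ℕ}
    (hf : IsPowCentral n j f) {μ : F} (hμ : IsPrimitiveRoot μ j) (m : ℕ) :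
    ∃ c : F, c ≠ 0 ∧ c • w n j μ ^ m ∈ image n (f ^ m) := by
  obtain ⟨A, hA, hA0⟩ := hf.exists_pow_ne_zero
  obtain ⟨c, t, hc, rfl⟩ := (hf.similar hμ hA).resolve_left hA0
  refine ⟨c ^ m, pow_ne_zero _ hc, ?_⟩
  rw [image_pow]
  refine ⟨_, conj_mem_image hA t, ?_⟩
  simp [mul_assoc, smul_pow]

end PowCentral

end NCPoly

theorem theorem3p3 {F : Type*} [Field F] [IsAlgClosed F] [CharZero F] (n : ℕ) (hn : 2 ≤ n)
    (d : ℕ) (f : FreeAlgebra F (Fin d)) :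
    (NCPoly.IsFiniteOn n f ↔ ∃ j : ℕ, NCPoly.IsPowCentral n j f) ∧
    ∀ j : ℕ, NCPoly.IsPowCentral n j f →
      j ∣ n ∧
      ∀ μ : F, IsPrimitiveRoot μ j →
        (∀ A ∈ NCPoly.image n f, ¬ IsNilpotent A → A ∈ NCPoly.simScalar (NCPoly.w n j μ)) ∧
        (∃ N : Set (Matrix (Fin n) (Fin n) F), N.Finite ∧ (∀ a ∈ N, IsNilpotent a) ∧
          NCPoly.image n f ⊆ NCPoly.simScalar (NCPoly.w n j μ) ∪ ⋃ a ∈ N, NCPoly.simScalar a) ∧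
        (∀ m : ℕ, j ≤ m →
          NCPoly.image n (f ^ m) ⊆ NCPoly.simScalar (NCPoly.w n j μ ^ m) ∧
          ∃ c : F, c ≠ 0 ∧ c • NCPoly.w n j μ ^ m ∈ NCPoly.image n (f ^ m)) ∧
        NCPoly.image n (f ^ (j + 1)) ⊆ NCPoly.simScalar (NCPoly.w n j μ) := by
  have : NeZero n := ⟨by omega⟩
  refine ⟨⟨NCPoly.exists_isPowCentral_of_isFiniteOn, fun ⟨j, hj⟩ => hj.isFiniteOn⟩,
    fun j hf => ⟨hf.dvd, fun μ hμ => ⟨fun A hA hnil => ?_, hf.image_subset hμ,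
      fun m hm => ⟨hf.image_pow_subset hμ hm, hf.exists_smul_w_pow_mem hμ m⟩, ?_⟩⟩⟩
  · rcases hf.similar hμ hA with h | ⟨c, t, -, h⟩
    · exact absurd ⟨j, h⟩ hnil
    · exact ⟨c, t, h⟩
  -- Since `w n j μ` has `j`-th power `1`, its power `j + 1` is itself.
  · have h := hf.image_pow_subset hμ (Nat.le_succ j)
    rwa [Nat.succ_eq_add_one, pow_succ (NCPoly.w n j μ), NCPoly.w_pow_eq_one hμ, one_mul] at h
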